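/- Let $V$ and $H$ be real Hilbert spaces, $V$ infinite-dimensional, with a dense and compact imbedding $V\subset H$; identify $H$ with its dual, so that $V\subset H\subset V'$. Let $L:V\to V'$ be the duality mapping, $\langle Lu,\phi\rangle=(u,\phi)_V$, and let $g:V\to V'$ be linear, continuous, symmetric and non-negative, i.e. $\langle gu,v\rangle=\langle gv,u\rangle$ and $\langle gu,u\rangle\ge 0$ for all $u,v\in V$. Let $A$ and $D$ be symmetric positive semi-definite real $N\times N$ matrices, and let $\mathcal L$ and $\mathcal G$ denote $L$ and $g$ acting componentwise on $V^N$. Consider the system $$U''+\mathcal L U+AU+D\mathcal G U'=0,\qquad U=(u^{(1)},\dots,u^{(N)})^T. \tag{1.2}$$ For initial data $(U_0,U_1)\in (V\times H)^N$, its weak solution is the function $U\in C^0([0,\infty),V^N)\cap C^1([0,\infty),H^N)$ with $U(0)=U_0$, $U'(0)=U_1$ and $(U'+D\mathcal G U)'+\mathcal LU+AU=0$ weakly in $(V')^N$, i.e. when tested componentwise with elements of $V$. The system is called uniformly stable in $(V\times H)^N$ if there are constants $M\ge 1$ and $\omega>0$ such that for all $(U_0,U_1)\in(V\times H)^N$ the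 corresponding weak solution satisfies $$\|(U(t),U'(t))\|_{(V\times H)^N}\le M e^{-\omega t}\|(U_0,U_1)\|_{(V\times H)^N},\qquad t\ge 0.$$ If system (1.2) is uniformly stable in $(V\times H)^N$, then $\operatorname{rank}(D)=N$. -/

import Mathlib

open Set

/-- The norm of `(u, v)` in `(V × H)^N`: the square root of
`∑ₖ (‖u⁽ᵏ⁾‖_V² + ‖v⁽ᵏ⁾‖_H²)`. -/
noncomputable def energyNorm {V H : Type*} [NormedAddCommGroup V] [NormedAddCommGroup H] {N : ℕ}
    (u : Fin N → V) (v : Fin N → H) : ℝ :=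
  Real.sqrt (∑ k, (‖u k‖ ^ 2 + ‖v k‖ ^ 2))

/-- `U`, with time derivative `U'` (the function `dU`), is the weak solution of
`U'' + 𝓛 U + A U + D 𝒢 U' = 0` on `[0, ∞)` with `U(0) = U₀`, `U'(0) = U₁`.

Here `i : V → H` is the imbedding, and `H` is imbedded in `V'` by `h ↦ (h, i ·)_H`. The diagonal
operator `𝓛` is given by the duality mapping `⟨L u, φ⟩ = (u, φ)_V` and `𝒢` by `g : V → V'`.
The solution lies in `C⁰([0, ∞), V^N) ∩ C¹([0, ∞), H^N)`. Since `U'(t)` is only in `H^N`,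
the damping `D 𝒢 U'` is `(D 𝒢 U)'`, as usual, and the system reads
`(U' + D 𝒢 U)' + 𝓛 U + A U = 0` in `(V')^N`, tested componentwise with `φ ∈ V`.
Only the values at times `t ≥ 0` matter. -/
structure IsWeakSolution {V H : Type*}
    [NormedAddCommGroup V] [InnerProductSpace ℝ V] [NormedAddCommGroup H] [InnerProductSpace ℝ H]
    {N : ℕ} (i : V →L[ℝ] H) (g : V →L[ℝ] StrongDual ℝ V) (A D : Matrix (Fin N) (Fin N) ℝ)
    (U₀ : Fin N → V) (U₁ : Fin N → H) (U : ℝ → Fin N → V) (dU : ℝ → Fin N → H) : Prop where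
  continuousOn : ContinuousOn U (Ici 0)
  continuousOn_deriv : ContinuousOn dU (Ici 0)
  hasDeriv : ∀ t, 0 ≤ t → ∀ k, HasDerivWithinAt (fun s => i (U s k)) (dU t k) (Ici 0) t
  equation : ∀ t, 0 ≤ t → ∀ (k : Fin N) (φ : V),
    HasDerivWithinAt
      (fun s => inner ℝ (dU s k) (i φ) + ∑ l, D k l * g (U s l) φ)
      (-(inner ℝ (U t k) φ + ∑ l, A k l * inner ℝ (i (U t l)) (i φ))) (Ici 0) t
  initial : U 0 = U₀
  initial_deriv : dU 0 = U₁

/-- Uniform (exponential) stability of `U'' + 𝓛 U + A U + D 𝒢 U' = 0` in `(V × H)^N`. -/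
def UniformlyStable {V H : Type*}
    [NormedAddCommGroup V] [InnerProductSpace ℝ V] [NormedAddCommGroup H] [InnerProductSpace ℝ H]
    {N : ℕ} (i : V →L[ℝ] H) (g : V →L[ℝ] StrongDual ℝ V)
    (A D : Matrix (Fin N) (Fin N) ℝ) : Prop :=
  ∃ M ω : ℝ, 1 ≤ M ∧ 0 < ω ∧
    ∀ (U₀ : Fin N → V) (U₁ : Fin N → H) (U : ℝ → Fin N → V) (dU : ℝ → Fin N → H),
      IsWeakSolution i g A D U₀ U₁ U dU →
      ∀ t, 0 ≤ t → energyNorm (U t) (dU t) ≤ M * Real.exp (-ω * t) * energyNorm U₀ U₁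

/-!
The energy argument is as follows. If `D` is singular, a unit vector `e` satisfies `eᵀ D = 0`, and
the component `w = e · U` of a solution obeys the undamped equation `w'' + L w = -e · A U`. Its
energy `‖w‖² + ‖w'‖²` changes only by the integral of `2 (e · A U, w')_H`. Along initial data
`(e fₙ, 0)` with `fₙ` orthonormal in `V`, the solution tends to zero weakly at each time, so
`U(s) → 0` in `H` by compactness of the imbedding; hence the energy of `w` at any fixed time tends
to its initial value `1`, which contradicts uniform exponential decay
(`IsWaveSemigroup.false_of_exponential_decay`).

The decay hypothesis only speaks about weak solutions that exist, so these have to be constructed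
(`exists_isWaveSemigroup`, `IsWaveSemigroup.isWeakSolution`). For this the Hille–Yosida theorem is
proved in the form `exists_contraction_semigroup`: the generator `𝒜` is never used as an unbounded
operator, only through its bounded resolvent `R = (1 - 𝒜)⁻¹`, for which dissipativity reads
`‖R x‖² ≤ (R x, x)` and the Yosida approximations are `(R - 1) (l + (1 - l) R)⁻¹`. For the damped
wave equation `R` comes from one coercive problem on `V^N` (`exists_wave_resolvent`), after a shift
of the generator that absorbs the lower order term `A`. The weak formulation follows for all
initial data from identities `ℓ 𝒜 = m` between bounded functionals
(`hasDerivWithinAt_of_intertwining`); the energy identity holds on the domain of `𝒜`, and the data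
`(e fₙ, 0)` are approximated from there.
-/

open Filter Topology NormedSpace

/-! ### Hille–Yosida theorem -/

section Yosida

variable {X : Type*} [NormedAddCommGroup X] [InnerProductSpace ℝ X]

lemma norm_apply_le_of_sq_le_inner {R : X →L[ℝ] X} (hR : ∀ x, ‖R x‖ ^ 2 ≤ inner ℝ (R x) x) (x : X) :
    ‖R x‖ ≤ ‖x‖ := by
  have h1 := hR x
  have h2 := real_inner_le_norm (R x) x
  by_contra! h
  nlinarith [norm_nonneg x, norm_nonneg (R x)]

lemma norm_apply_sub_le_of_sq_le_inner {R : X →L[ℝ] X}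
    (hR : ∀ x, ‖R x‖ ^ 2 ≤ inner ℝ (R x) x) (x : X) : ‖R x - x‖ ≤ ‖x‖ := by
  have h1 := norm_sub_sq_real (R x) x
  refine (pow_le_pow_iff_left₀ (norm_nonneg _) (norm_nonneg _) two_ne_zero).1 ?_
  linarith [hR x, sq_nonneg ‖R x‖]

/-- If bounded maps satisfy `ℓ ∘ (R - 1) = m ∘ R`, that is `ℓ 𝒜 = m` on the domain of the
generator `𝒜`, then `(ℓ S(t) x)' = m S(t) x` for every `x`, not only for `x` in the domain: write
`ℓ = ℓ R - m R`. -/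
lemma hasDerivWithinAt_of_intertwining {F : Type*} [NormedAddCommGroup F] [NormedSpace ℝ F]
    {R : X →L[ℝ] X} {S : ℝ → X →L[ℝ] X} (hSR : ∀ t x, S t (R x) = R (S t x))
    (hS : ∀ x t, 0 ≤ t → HasDerivWithinAt (fun s => S s (R x)) (S t (R x - x)) (Ici 0) t)
    (L m : X →L[ℝ] F) (hlm : ∀ x, L (R x - x) = m (R x)) (x : X) {t : ℝ} (ht : 0 ≤ t) :
    HasDerivWithinAt (fun s => L (S s x)) (m (S t x)) (Ici 0) t := by
  have h1 := ((L - m).hasFDerivAt.comp_hasDerivWithinAt t (hS x t ht))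
  have e : ∀ s, L (S s x) = (L - m) (S s (R x)) := by
    intro s
    have := hlm (S s x)
    simp only [map_sub] at this
    rw [hSR, sub_apply, ← this]
    abel
  have e2 : (L - m) (S t (R x - x)) = m (S t x) := by
    have h3 := hlm (S t x)
    rw [map_sub, hSR, sub_apply, h3]
    simp
  rw [e2] at h1
  exact h1.congr (fun s _ => e s) (e t)

/-- `B` is a Yosida approximation with parameter `l` of the operator whose resolvent at `1` is
`R`, that is of `𝒜 = 1 - R⁻¹`, and `J = 1 + l B` is the resolvent `(1 - l 𝒜)⁻¹`. -/
structure IsYosida (R : X →L[ℝ] X) (l : ℝ) (B J : X →L[ℝ] X) : Prop where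
  dissipative : ∀ x, inner ℝ (B x) x ≤ 0
  eq : J = 1 + l • B
  contraction : ∀ x, ‖J x‖ ≤ ‖x‖
  mul_R : B * R = J * (R - 1)
  comm : ∀ F, Commute R F → Commute B F

/-- On the range of `R`, the resolvents `J` approximate the identity with rate `l`. -/
lemma IsYosida.norm_apply_resolvent_sub_le {R B J : X →L[ℝ] X} {l : ℝ}
    (hR : ∀ x, ‖R x‖ ^ 2 ≤ inner ℝ (R x) x) (hl : 0 ≤ l) (h : IsYosida R l B J) (x : X) :
    ‖J (R x) - R x‖ ≤ l * ‖x‖ := by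
  have h1 : J (R x) - R x = l • J (R x - x) := by
    have e := congrArg (fun F : X →L[ℝ] X => F x) h.mul_R
    simp only [mul_apply_eq_comp, sub_apply,
      one_apply_eq_self] at e
    rw [← e, h.eq]
    simp
  rw [h1, norm_smul, Real.norm_of_nonneg hl]
  gcongr
  exact (h.contraction _).trans (norm_apply_sub_le_of_sq_le_inner hR x)

/-- On the range of `R²`, the Yosida approximations approximate the generator with rate `l`; here
`(R - 1) R w` is the generator applied to `R² w`. -/
lemma IsYosida.norm_apply_sub_le {R B J : X →L[ℝ] X} {l : ℝ}
    (hR : ∀ x, ‖R x‖ ^ 2 ≤ inner ℝ (R x) x) (hl : 0 ≤ l) (h : IsYosida R l B J) (w : X) :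
    ‖B (R (R w)) - (R - 1) (R w)‖ ≤ l * ‖w‖ := by
  have e := congrArg (fun F : X →L[ℝ] X => F (R w)) h.mul_R
  simp only [mul_apply_eq_comp, sub_apply,
      one_apply_eq_self] at e
  have h1 : B (R (R w)) - (R - 1) (R w) = J (R (R w - w)) - R (R w - w) := by
    rw [e]; simp [map_sub]
  rw [h1]
  refine (h.norm_apply_resolvent_sub_le hR hl _).trans ?_
  gcongr
  exact norm_apply_sub_le_of_sq_le_inner hR w

variable [CompleteSpace X]

/-- The exponential `exp (t B)` of a bounded dissipative operator is a contraction for `t ≥ 0`. -/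
lemma norm_exp_smul_apply_le {B : X →L[ℝ] X} (hB : ∀ x, inner ℝ (B x) x ≤ 0)
    {t : ℝ} (ht : 0 ≤ t) (x : X) : ‖exp (t • B) x‖ ≤ ‖x‖ := by
  have hd : ∀ s : ℝ, HasDerivAt (fun s : ℝ => ‖exp (s • B) x‖ ^ 2)
      (2 * inner ℝ (exp (s • B) x) (B (exp (s • B) x))) s := by
    intro s
    have h := (hasDerivAt_exp_smul_const' (𝕂 := ℝ) B s).clm_apply (hasDerivAt_const s x)
    simpa using h.norm_sq
  have hanti : Antitone (fun s : ℝ => ‖exp (s • B) x‖ ^ 2) := by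
    refine antitone_of_deriv_nonpos (fun s => (hd s).differentiableAt) fun s => ?_
    rw [(hd s).deriv, real_inner_comm]
    have := hB (exp (s • B) x)
    linarith
  have := hanti ht
  simp only [zero_smul, exp_zero, one_apply_eq_self] at this
  exact (pow_le_pow_iff_left₀ (norm_nonneg _) (norm_nonneg _) two_ne_zero).1 this

/-- Contraction semigroups with commuting bounded dissipative generators differ by at most `t` times
the difference of the generators, vector by vector. -/
lemma norm_exp_smul_sub_exp_smul_le {B B' : X →L[ℝ] X} (hB : ∀ x, inner ℝ (B x) x ≤ 0)
    (hB' : ∀ x, inner ℝ (B' x) x ≤ 0) (hc : Commute B B') {t : ℝ} (ht : 0 ≤ t) (x : X) :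
    ‖exp (t • B) x - exp (t • B') x‖ ≤ t * ‖B x - B' x‖ := by
  -- differentiate `s ↦ exp (s B) exp ((t - s) B')` along `[0, t]`
  have hd : ∀ s : ℝ, HasDerivAt (fun s : ℝ => exp (s • B) (exp ((t - s) • B') x))
      (exp (s • B) (exp ((t - s) • B') (B x - B' x))) s := by
    intro s
    have h1 := hasDerivAt_exp_smul_const (𝕂 := ℝ) B s
    have h2 := ((hasDerivAt_exp_smul_const (𝕂 := ℝ) B' (t - s)).scomp s
      ((hasDerivAt_id s).const_sub t)).clm_apply (hasDerivAt_const s x)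
    have h3 : HasDerivAt (fun s : ℝ => exp (s • B) (exp ((t - s) • B') x))
        (exp (s • B) (B (exp ((t - s) • B') x)) + exp (s • B)
          (((-1 : ℝ) • (exp ((t - s) • B') * B')) x + exp ((t - s) • B') 0)) s := h1.clm_apply h2
    have hcomm : Commute B (exp ((t - s) • B')) := (hc.smul_right (t - s)).exp_right
    have := congrArg (fun F : X →L[ℝ] X => F x) hcomm.eq
    simp only [mul_apply_eq_comp] at this
    convert h3 using 1
    simp [this, ← sub_eq_add_neg]
  have := norm_image_sub_le_of_norm_deriv_le_segment' (a := 0) (b := t)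
    (C := ‖B x - B' x‖) (fun s _ => (hd s).hasDerivWithinAt)
    (fun s hs => (norm_exp_smul_apply_le hB hs.1 _).trans
      (norm_exp_smul_apply_le hB' (sub_nonneg.2 hs.2.le) _)) t ⟨ht, le_rfl⟩
  simpa [mul_comm] using this

/-- In terms of the resolvent `R` at `1`, the Yosida approximation with parameter `l` is
`(R - 1) T⁻¹`, where `T = l + (1 - l) R` is coercive. -/
lemma exists_isYosida {R : X →L[ℝ] X} (hR : ∀ x, ‖R x‖ ^ 2 ≤ inner ℝ (R x) x)
    {l : ℝ} (hl : 0 < l) (hl1 : l ≤ 1) : ∃ B J, IsYosida R l B J := by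
  set T : X →L[ℝ] X := l • 1 + (1 - l) • R with hT
  have hTx : ∀ x, T x = l • x + (1 - l) • R x := fun x => by simp [hT]
  have hu : IsUnit T := by
    refine ContinuousLinearMap.isUnit_of_forall_le_norm_inner_map T (c := ⟨l, hl.le⟩) hl ?_
    intro x
    refine le_trans ?_ (le_abs_self _)
    rw [hTx, inner_add_left, inner_smul_left, inner_smul_left, real_inner_self_eq_norm_sq]
    have : 0 ≤ inner ℝ (R x) x := (sq_nonneg _).trans (hR x)
    have := mul_nonneg (sub_nonneg.2 hl1) this
    change ‖x‖ ^ 2 * l ≤ _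
    simp only [conj_trivial]
    linarith
  obtain ⟨u, hu⟩ := hu
  set G : X →L[ℝ] X := ↑u⁻¹ with hG
  have hTG : T * G = 1 := by rw [← hu, hG]; simp
  have hGT : G * T = 1 := by rw [← hu, hG]; simp
  have hGcomm : ∀ F, Commute R F → Commute G F := by
    intro F hF
    have : Commute (u : X →L[ℝ] X) F := by
      rw [hu, hT]
      exact ((Commute.one_left F).smul_left l).add_left (hF.smul_left _)
    exact this.units_inv_left
  have hRG : G * R = R * G := (hGcomm R (Commute.refl R)).eq
  have hJ : R * G = 1 + l • ((R - 1) * G) := by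
    have h : l • G + (1 - l) • (R * G) = 1 := by
      rw [← hTG, hT]
      simp only [add_mul, smul_mul_assoc, one_mul]
    rw [sub_mul, one_mul, ← h, smul_sub, sub_smul, one_smul]
    abel
  have hsurj : ∀ x, ∃ z, x = T z := fun x => ⟨G x, by
    rw [← mul_apply_eq_comp, hTG, one_apply_eq_self]⟩
  have hGTz : ∀ z, G (T z) = z := fun z => by
    rw [← mul_apply_eq_comp, hGT, one_apply_eq_self]
  refine ⟨(R - 1) * G, R * G, ?_, hJ, ?_, ?_, ?_⟩
  · intro x
    obtain ⟨z, rfl⟩ := hsurj x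
    have h1 := hR z
    have h2 := real_inner_le_norm (R z) z
    have h3 := norm_apply_le_of_sq_le_inner hR z
    simp only [mul_apply_eq_comp, hGTz, sub_apply, one_apply_eq_self]
    simp only [hTx, inner_add_right, inner_sub_left, inner_smul_right,
      real_inner_self_eq_norm_sq]
    rw [real_inner_comm (R z) z]
    have h4 := mul_nonneg (sub_nonneg.2 hl1) (sub_nonneg.2 h1)
    have h5 : inner ℝ (R z) z ≤ ‖z‖ ^ 2 := by nlinarith [norm_nonneg z]
    nlinarith
  · intro x
    obtain ⟨z, rfl⟩ := hsurj x
    simp only [mul_apply_eq_comp, hGTz]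
    have h1 : ‖R z‖ ^ 2 ≤ inner ℝ (T z) (R z) := by
      rw [hTx, inner_add_left, inner_smul_left, inner_smul_left, real_inner_self_eq_norm_sq,
        real_inner_comm]
      simp only [conj_trivial]
      nlinarith [hR z]
    have h2 := real_inner_le_norm (T z) (R z)
    by_contra! h
    nlinarith [norm_nonneg (T z), norm_nonneg (R z)]
  · rw [mul_assoc, hRG, mul_assoc, mul_sub, mul_one, hRG, sub_mul, one_mul, mul_sub]
  · intro F hF
    exact (hF.sub_left (Commute.one_left F)).mul_left (hGcomm F hF)

/-- The Hille–Yosida theorem for a densely defined dissipative operator `𝒜`, expressed through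
`R = (1 - 𝒜)⁻¹`. -/
theorem exists_contraction_semigroup {R : X →L[ℝ] X} (hR : ∀ x, ‖R x‖ ^ 2 ≤ inner ℝ (R x) x)
    (hdense : DenseRange R) :
    ∃ S : ℝ → X →L[ℝ] X, (∀ t x, ‖S t x‖ ≤ ‖x‖) ∧ S 0 = 1 ∧ (∀ x, Continuous fun t => S t x) ∧
      (∀ t x, S t (R x) = R (S t x)) ∧
      ∀ x t, 0 ≤ t → HasDerivWithinAt (fun s => S s (R x)) (S t (R x - x)) (Ici 0) t := by
  set l : ℕ → ℝ := fun n => 1 / ((n : ℝ) + 1) with hl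
  have hl0 : ∀ n, 0 < l n := fun n => by simp only [hl]; positivity
  have hl1 : ∀ n, l n ≤ 1 := fun n => by
    simp only [hl]
    rw [div_le_one (by positivity)]
    linarith [Nat.cast_nonneg (α := ℝ) n]
  have hltend : Tendsto l atTop (𝓝 0) := tendsto_one_div_add_atTop_nhds_zero_nat
  choose B J hBJ using fun n => exists_isYosida hR (hl0 n) (hl1 n)
  have hBR : ∀ n, Commute (B n) R := fun n => (hBJ n).comm R (Commute.refl R)
  have hBB : ∀ n m, Commute (B n) (B m) := fun n m => (hBJ n).comm _ (hBR m).symm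
  -- for negative times the value at `0` is used, which makes every estimate hold for all `t`
  set E : ℕ → ℝ → X →L[ℝ] X := fun n t => exp (max t 0 • B n) with hE
  have hEle : ∀ n t x, ‖E n t x‖ ≤ ‖x‖ := fun n t x =>
    norm_exp_smul_apply_le (hBJ n).dissipative (le_max_right _ _) x
  have hdense2 : DenseRange fun w => R (R w) := hdense.comp hdense R.continuous
  -- on the range of `R²` the approximations are Cauchy with an explicit rate
  have hrate : ∀ n m t w, ‖E n t (R (R w)) - E m t (R (R w))‖
      ≤ max t 0 * ((l n + l m) * ‖w‖) := by
    intro n m t w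
    refine (norm_exp_smul_sub_exp_smul_le (hBJ n).dissipative (hBJ m).dissipative (hBB n m)
      (le_max_right _ _) _).trans ?_
    gcongr
    have h1 := (hBJ n).norm_apply_sub_le hR (hl0 n).le w
    have h2 := (hBJ m).norm_apply_sub_le hR (hl0 m).le w
    have h3 := norm_sub_le_norm_sub_add_norm_sub (B n (R (R w))) ((R - 1) (R w)) (B m (R (R w)))
    rw [norm_sub_rev ((R - 1) (R w)) (B m (R (R w)))] at h3
    linarith
  have hcauchy : ∀ x (a : ℝ), UniformCauchySeqOn (fun n t => E n t x) atTop (Iic a) := by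
    intro x a
    rw [Metric.uniformCauchySeqOn_iff]
    intro ε hε
    obtain ⟨w, hw⟩ := hdense2.exists_dist_lt x (show 0 < ε / 4 by positivity)
    rw [dist_eq_norm] at hw
    have ht' : Tendsto (fun n => max a 0 * (l n * ‖w‖)) atTop (𝓝 0) := by
      have := (((hltend).mul_const ‖w‖).const_mul (max a 0))
      simpa using this
    obtain ⟨n0, hn0⟩ := eventually_atTop.1 (ht'.eventually (gt_mem_nhds (show 0 < ε / 4 by positivity)))
    refine ⟨n0, fun m hm n hn t hta => ?_⟩
    rw [dist_eq_norm]
    have e : E m t x - E n t x = E m t (x - R (R w)) - E n t (x - R (R w))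
        + (E m t (R (R w)) - E n t (R (R w))) := by
      simp only [map_sub]; abel
    have h1 := hEle m t (x - R (R w))
    have h2 := hEle n t (x - R (R w))
    have h3 := hrate m n t w
    have h4 : max t 0 * ((l m + l n) * ‖w‖) ≤ max a 0 * ((l m + l n) * ‖w‖) := by
      have := hl0 m
      have := hl0 n
      gcongr
      exact hta
    have h5 := hn0 m hm
    have h6 := hn0 n hn
    rw [e]
    have h7 := norm_add_le (E m t (x - R (R w)) - E n t (x - R (R w)))
      (E m t (R (R w)) - E n t (R (R w)))
    have h8 := norm_sub_le (E m t (x - R (R w))) (E n t (x - R (R w)))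
    linarith
  have hlim : ∀ t x, ∃ y, Tendsto (fun n => E n t x) atTop (𝓝 y) := fun t x =>
    cauchySeq_tendsto_of_complete ((hcauchy x t).cauchySeq (mem_Iic.2 le_rfl))
  choose s hs using hlim
  set S : ℝ → X →L[ℝ] X := fun t => LinearMap.mkContinuous
    { toFun := s t
      map_add' := fun x y => tendsto_nhds_unique (hs t (x + y))
        (by simpa only [map_add] using (hs t x).add (hs t y))
      map_smul' := fun c x => tendsto_nhds_unique (hs t (c • x))
        (by simpa only [map_smul, RingHom.id_apply] using (hs t x).const_smul c) } 1
    (fun x => by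
      rw [one_mul]
      exact le_of_tendsto (hs t x).norm (Eventually.of_forall fun n => hEle n t x)) with hS
  have hSlim : ∀ t x, Tendsto (fun n => E n t x) atTop (𝓝 (S t x)) := hs
  have hSle : ∀ t x, ‖S t x‖ ≤ ‖x‖ := fun t x =>
    le_of_tendsto (hs t x).norm (Eventually.of_forall fun n => hEle n t x)
  have hexp : ∀ n, Continuous fun t : ℝ => exp (t • B n) := fun n =>
    continuous_iff_continuousAt.2 fun t => (hasDerivAt_exp_smul_const (𝕂 := ℝ) (B n) t).continuousAt
  have hEcont : ∀ n x, Continuous fun t => E n t x := by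
    intro n x
    exact ((hexp n).comp (continuous_id.max continuous_const)).clm_apply continuous_const
  have hScont : ∀ x, Continuous fun t => S t x := by
    intro x
    rw [continuous_iff_continuousAt]
    intro t
    have h := ((hcauchy x (t + 1)).tendstoUniformlyOn_of_tendsto
      (fun r _ => hSlim r x)).continuousOn (Frequently.of_forall fun n => (hEcont n x).continuousOn)
    exact h.continuousAt (Iic_mem_nhds (by linarith))
  have hSR : ∀ t x, S t (R x) = R (S t x) := by
    intro t x
    refine tendsto_nhds_unique (hSlim t (R x)) ?_
    refine ((R.continuous.tendsto _).comp (hSlim t x)).congr fun n => ?_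
    have : Commute (E n t) R := ((hBR n).smul_left _).exp_left
    exact congrArg (fun F : X →L[ℝ] X => F x) this.eq.symm
  have hJ : ∀ z, Tendsto (fun n => J n z) atTop (𝓝 z) := by
    intro z
    rw [Metric.tendsto_atTop]
    intro ε hε
    obtain ⟨w, hw⟩ := hdense.exists_dist_lt z (show 0 < ε / 3 by positivity)
    rw [dist_eq_norm] at hw
    have ht' : Tendsto (fun n => l n * ‖w‖) atTop (𝓝 0) := by
      simpa using hltend.mul_const ‖w‖
    obtain ⟨n0, hn0⟩ := eventually_atTop.1 (ht'.eventually (gt_mem_nhds (show 0 < ε / 3 by positivity)))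
    refine ⟨n0, fun n hn => ?_⟩
    rw [dist_eq_norm]
    have e : J n z - z = J n (z - R w) + (J n (R w) - R w) - (z - R w) := by
      simp only [map_sub]; abel
    rw [e]
    have h1 := (hBJ n).contraction (z - R w)
    have h2 := (hBJ n).norm_apply_resolvent_sub_le hR (hl0 n).le w
    have h3 := norm_sub_le (J n (z - R w) + (J n (R w) - R w)) (z - R w)
    have h4 := norm_add_le (J n (z - R w)) (J n (R w) - R w)
    linarith [hn0 n hn]
  have hint : ∀ x t, 0 ≤ t → S t (R x) = R x + ∫ r in (0 : ℝ)..t, S r (R x - x) := by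
    intro x t ht
    have h1 : ∀ n, E n t (R x) = R x + ∫ r in (0 : ℝ)..t, E n r (J n (R x - x)) := by
      intro n
      have hd : ∀ r ∈ uIcc 0 t, HasDerivAt (fun r : ℝ => exp (r • B n) (R x))
          (exp (r • B n) (J n (R x - x))) r := by
        intro r _
        have h := (hasDerivAt_exp_smul_const (𝕂 := ℝ) (B n) r).clm_apply (hasDerivAt_const r (R x))
        have e := congrArg (fun F : X →L[ℝ] X => F x) (hBJ n).mul_R
        simp only [mul_apply_eq_comp, sub_apply,
          one_apply_eq_self] at e
        simpa [e] using h
      have hc : Continuous fun r : ℝ => exp (r • B n) (J n (R x - x)) :=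
        (hexp n).clm_apply continuous_const
      have := intervalIntegral.integral_eq_sub_of_hasDerivAt hd (hc.intervalIntegrable _ _)
      have hcongr : ∫ r in (0 : ℝ)..t, E n r (J n (R x - x)) =
          ∫ r in (0 : ℝ)..t, exp (r • B n) (J n (R x - x)) := by
        refine intervalIntegral.integral_congr fun r hr => ?_
        rw [uIcc_of_le ht] at hr
        simp [hE, max_eq_left hr.1]
      rw [hcongr, this]
      simp [hE, max_eq_left ht]
    have h2 : Tendsto (fun n => ∫ r in (0 : ℝ)..t, E n r (J n (R x - x))) atTop
        (𝓝 (∫ r in (0 : ℝ)..t, S r (R x - x))) := by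
      refine intervalIntegral.tendsto_integral_filter_of_dominated_convergence
        (fun _ => ‖R x - x‖) (Eventually.of_forall fun n =>
          (hEcont n _).aestronglyMeasurable) (Eventually.of_forall fun n =>
          Eventually.of_forall fun r _ => (hEle n r _).trans ((hBJ n).contraction _))
        intervalIntegrable_const (Eventually.of_forall fun r _ => ?_)
      have e : ∀ n, E n r (J n (R x - x)) = E n r (R x - x)
          + E n r (J n (R x - x) - (R x - x)) := fun n => by
        rw [← map_add]; congr 1; abel
      simp only [e]
      have h3 : Tendsto (fun n => E n r (J n (R x - x) - (R x - x))) atTop (𝓝 0) := by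
        refine squeeze_zero_norm (fun n => hEle n r _) ?_
        simpa using ((hJ (R x - x)).sub_const (R x - x)).norm
      simpa using (hSlim r (R x - x)).add h3
    refine tendsto_nhds_unique (hSlim t (R x)) ?_
    simp only [h1]
    exact h2.const_add _
  refine ⟨S, hSle, ?_, hScont, hSR, ?_⟩
  · ext x
    refine tendsto_nhds_unique (hSlim 0 x) ?_
    simp [hE]
  · intro x t ht
    have h1 : HasDerivAt (fun r => R x + ∫ r in (0 : ℝ)..r, S r (R x - x)) (S t (R x - x)) t :=
      ((hScont (R x - x)).integral_hasStrictDerivAt 0 t).hasDerivAt.const_add _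
    exact h1.hasDerivWithinAt.congr (fun r hr => hint x r hr) (hint x t ht)

end Yosida

/-! ### Damped wave equation in a Hilbert space -/

/-- A dissipative operator that has a resolvent `R` is densely defined. -/
lemma denseRange_of_sq_le_inner {X : Type*} [NormedAddCommGroup X] [InnerProductSpace ℝ X]
    [CompleteSpace X] {R : X →L[ℝ] X} (hR : ∀ x, ‖R x‖ ^ 2 ≤ inner ℝ (R x) x)
    (hinj : Function.Injective R) : DenseRange R := by
  have h : (LinearMap.range (R : X →ₗ[ℝ] X))ᗮ = ⊥ := by
    rw [Submodule.eq_bot_iff]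
    intro x hx
    have h1 : inner ℝ (R x) x = 0 := (Submodule.mem_orthogonal _ _).1 hx (R x) ⟨x, rfl⟩
    have h2 := hR x
    rw [h1] at h2
    have h3 : R x = 0 := by
      rw [← norm_eq_zero]
      exact pow_eq_zero_iff two_ne_zero |>.1 (le_antisymm h2 (sq_nonneg _))
    exact hinj (by rw [h3, map_zero])
  have := Submodule.dense_iff_topologicalClosure_eq_top.2 (Submodule.topologicalClosure_eq_top_iff.2 h)
  exact this

lemma hasDerivWithinAt_exp_const_mul (c t : ℝ) :
    HasDerivWithinAt (fun s : ℝ => Real.exp (c * s)) (c * Real.exp (c * t)) (Ici 0) t := by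
  have := ((hasDerivAt_id t).const_mul c).exp.hasDerivWithinAt (s := Ici (0 : ℝ))
  simpa [mul_comm] using this

/-- The form of `hasDerivWithinAt_of_intertwining` for `exp (c t) S(t)`, where `S` is generated by
`𝒜 - c` and `ℓ 𝒜 = m` on the domain of `𝒜`. -/
lemma hasDerivWithinAt_exp_smul_of_intertwining {X F : Type*} [NormedAddCommGroup X]
    [InnerProductSpace ℝ X] [NormedAddCommGroup F] [NormedSpace ℝ F]
    {R : X →L[ℝ] X} {S : ℝ → X →L[ℝ] X} (hSR : ∀ t x, S t (R x) = R (S t x))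
    (hS : ∀ x t, 0 ≤ t → HasDerivWithinAt (fun s => S s (R x)) (S t (R x - x)) (Ici 0) t)
    (c : ℝ) (L m : X →L[ℝ] F) (hlm : ∀ x, L (R x - x) = m (R x) - c • L (R x)) (x : X) (t : ℝ)
    (ht : 0 ≤ t) :
    HasDerivWithinAt (fun s => L ((Real.exp (c * s) • S s) x))
      (m ((Real.exp (c * t) • S t) x)) (Ici 0) t := by
  have h1 := hasDerivWithinAt_of_intertwining hSR hS L (m - c • L) (fun x => by simp [hlm x]) x ht
  have h2 := (hasDerivWithinAt_exp_const_mul c t).smul h1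
  simp only [smul_apply, map_smul]
  refine h2.congr_deriv ?_
  simp only [sub_apply, smul_apply, smul_sub, smul_smul, mul_comm]
  abel

section Wave

variable {W Y : Type*} [NormedAddCommGroup W] [InnerProductSpace ℝ W]
  [NormedAddCommGroup Y] [InnerProductSpace ℝ Y]

/-- The solution operators `Z t` of `(v + b u)' + u + a j u = 0`, `(j u)' = v` on `W × Y`. The
energy of solutions starting in a dense set, the domain of the generator, can be differentiated. -/
structure IsWaveSemigroup (j : W →L[ℝ] Y) (a : Y →L[ℝ] Y) (b : W →L[ℝ] W)
    (Z : ℝ → WithLp 2 (W × Y) →L[ℝ] WithLp 2 (W × Y)) (D : Set (WithLp 2 (W × Y))) : Prop where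
  zero : Z 0 = 1
  continuous : ∀ x, Continuous fun t => Z t x
  hasDeriv_fst : ∀ x t, 0 ≤ t →
    HasDerivWithinAt (fun s => j (Z s x).fst) (Z t x).snd (Ici 0) t
  hasDeriv_snd : ∀ x t, 0 ≤ t → ∀ φ,
    HasDerivWithinAt (fun s => inner ℝ (Z s x).snd (j φ) + inner ℝ (b (Z s x).fst) φ)
      (-(inner ℝ (Z t x).fst φ + inner ℝ (a (j (Z t x).fst)) (j φ))) (Ici 0) t
  dense : Dense D
  hasDeriv : ∀ x ∈ D, ∀ t, 0 ≤ t → ∃ y : WithLp 2 (W × Y),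
    HasDerivWithinAt (fun s => Z s x) y (Ici 0) t ∧ j y.fst = (Z t x).snd ∧
    ∀ φ, inner ℝ y.snd (j φ) = -inner ℝ (Z t x).fst φ - inner ℝ (a (j (Z t x).fst)) (j φ)
      - inner ℝ (b y.fst) φ

variable [CompleteSpace W] [CompleteSpace Y]

/-- For `𝒜 (u, j p) = (p, f)` with `(f, j φ) = -(u, φ) - (a j u, j φ) - (b p, φ)`, the operator
`𝒜 - c` has a resolvent at `1`. -/
lemma exists_wave_resolvent (j : W →L[ℝ] Y) (a : Y →L[ℝ] Y) (b : W →L[ℝ] W)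
    (hb : ∀ w, 0 ≤ inner ℝ (b w) w) {c : ℝ} (hc : 0 ≤ c) (hac : ‖a‖ ≤ c) :
    ∃ R : WithLp 2 (W × Y) →L[ℝ] WithLp 2 (W × Y),
      (∀ x, j ((R x - x).fst + c • (R x).fst) = (R x).snd) ∧
      ∀ x φ, inner ℝ (R x - x).snd (j φ) =
        -inner ℝ (R x).fst φ - inner ℝ (a (j (R x).fst)) (j φ)
          - inner ℝ (b ((R x - x).fst + c • (R x).fst)) φ - c * inner ℝ (R x).snd (j φ) := by
  -- eliminating `v = j (μ u - h)` from `(u, v) = R (h, k)` leaves the coercive equation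
  -- `T u = j† k + μ j† j h + b h` for `u`
  set μ : ℝ := 1 + c with hμ
  set T : W →L[ℝ] W := 1 + μ • b + j.adjoint ∘L (μ ^ 2 • (1 : Y →L[ℝ] Y) + a) ∘L j with hT
  have hTinner : ∀ u φ, inner ℝ (T u) φ = inner ℝ u φ + μ * inner ℝ (b u) φ
      + μ ^ 2 * inner ℝ (j u) (j φ) + inner ℝ (a (j u)) (j φ) := by
    intro u φ
    simp [hT, inner_add_left, inner_smul_left, ContinuousLinearMap.adjoint_inner_left]
    ring
  have hu : IsUnit T := by
    refine ContinuousLinearMap.isUnit_of_forall_le_norm_inner_map T (c := 1) one_pos ?_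
    intro x
    refine le_trans ?_ (le_abs_self _)
    rw [hTinner, real_inner_self_eq_norm_sq, real_inner_self_eq_norm_sq]
    have h1 := (abs_le.1 (abs_real_inner_le_norm (a (j x)) (j x))).1
    have h2 := a.le_opNorm (j x)
    have h3 := mul_nonneg (show 0 ≤ μ by linarith) (hb x)
    have h4 : ‖a (j x)‖ * ‖j x‖ ≤ c * ‖j x‖ ^ 2 := by
      have : ‖a (j x)‖ ≤ c * ‖j x‖ := h2.trans (by gcongr)
      nlinarith [norm_nonneg (j x)]
    have h5 : c * ‖j x‖ ^ 2 ≤ μ ^ 2 * ‖j x‖ ^ 2 := by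
      gcongr
      nlinarith
    simp only [NNReal.coe_one, mul_one]
    linarith
  obtain ⟨T', hT'⟩ := hu
  set G : W →L[ℝ] W := ↑T'⁻¹ with hG
  have hTG : ∀ x, T (G x) = x := by
    intro x
    rw [← mul_apply_eq_comp, ← hT', hG]
    simp
  set q1 := WithLp.fstL 2 ℝ W Y
  set q2 := WithLp.sndL 2 ℝ W Y
  set Ru : WithLp 2 (W × Y) →L[ℝ] W :=
    G ∘L (j.adjoint ∘L q2 + μ • (j.adjoint ∘L j ∘L q1) + b ∘L q1) with hRu
  set Rv : WithLp 2 (W × Y) →L[ℝ] Y := j ∘L (μ • Ru - q1) with hRv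
  set R : WithLp 2 (W × Y) →L[ℝ] WithLp 2 (W × Y) :=
    ((WithLp.prodContinuousLinearEquiv 2 ℝ W Y).symm : W × Y →L[ℝ] WithLp 2 (W × Y)) ∘L
      (Ru.prod Rv) with hR
  have hR1 : ∀ x, (R x).fst = Ru x := fun x => rfl
  have hR2 : ∀ x, (R x).snd = j (μ • Ru x - x.fst) := fun x => rfl
  have hp : ∀ x, (R x - x).fst + c • (R x).fst = μ • Ru x - x.fst := by
    intro x
    rw [WithLp.sub_fst, hR1, hμ, add_smul, one_smul]
    abel
  refine ⟨R, fun x => by rw [hp, hR2], fun x φ => ?_⟩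
  have h1 : inner ℝ (T (Ru x)) φ
      = inner ℝ x.snd (j φ) + μ * inner ℝ (j x.fst) (j φ) + inner ℝ (b x.fst) φ := by
    rw [show T (Ru x) = j.adjoint x.snd + μ • j.adjoint (j x.fst) + b x.fst from hTG _]
    simp [inner_add_left, inner_smul_left, ContinuousLinearMap.adjoint_inner_left]
  rw [hTinner] at h1
  rw [hp, WithLp.sub_snd, hR2, hR1]
  simp only [map_sub, map_smul, inner_sub_left, inner_smul_left, conj_trivial]
  have hc' : c = μ - 1 := by rw [hμ]; ring
  rw [hc']
  linarith

/-- The damped wave equation is well posed on `W × Y`; only `b ≥ 0` is needed, as `a` is bounded. -/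
theorem exists_isWaveSemigroup (j : W →L[ℝ] Y) (hj : Function.Injective j) (hjd : DenseRange j)
    (a : Y →L[ℝ] Y) (b : W →L[ℝ] W) (hb : ∀ w, 0 ≤ inner ℝ (b w) w) :
    ∃ Z D, IsWaveSemigroup j a b Z D := by
  -- large enough for the resolvent problem (`‖a‖ ≤ c`) and for dissipativity (`‖a‖ * ‖j‖ ≤ c`)
  set c : ℝ := ‖a‖ * (1 + ‖j‖) with hc
  have hc0 : 0 ≤ c := by positivity
  have hac : ‖a‖ ≤ c := by
    rw [hc]; nlinarith [norm_nonneg a, norm_nonneg j, mul_nonneg (norm_nonneg a) (norm_nonneg j)]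
  have hajc : ‖a‖ * ‖j‖ ≤ c := by
    rw [hc]; nlinarith [norm_nonneg a, norm_nonneg j]
  obtain ⟨R, hR1, hR2⟩ := exists_wave_resolvent j a b hb hc0 hac
  have hR : ∀ x, ‖R x‖ ^ 2 ≤ inner ℝ (R x) x := by
    intro x
    have e : inner ℝ (R x) x = ‖R x‖ ^ 2 - inner ℝ (R x - x) (R x) := by
      rw [inner_sub_left, real_inner_self_eq_norm_sq, real_inner_comm]; ring
    have h1 := hR1 x
    have h2 := hR2 x ((R x - x).fst + c • (R x).fst)
    set u := (R x).fst
    set p := (R x - x).fst + c • u with hp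
    have hpf : (R x - x).fst = p - c • u := by rw [hp]; abel
    rw [e, WithLp.prod_inner_apply]
    change _ ≤ _ - (inner ℝ (R x - x).fst (R x).fst + inner ℝ (R x - x).snd (R x).snd)
    rw [← h1, h2, h1, hpf]
    change _ ≤ _ - (inner ℝ (p - c • u) u + _)
    rw [inner_sub_left, inner_smul_left, real_inner_self_eq_norm_sq, real_inner_self_eq_norm_sq,
      real_inner_comm]
    simp only [conj_trivial]
    have h3 := (abs_le.1 (abs_real_inner_le_norm (a (j u)) (R x).snd)).1
    have h4 : ‖a (j u)‖ ≤ c * ‖u‖ :=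
      (a.le_opNorm _).trans ((mul_le_mul_of_nonneg_left (j.le_opNorm u) (norm_nonneg a)).trans
        (by rw [← mul_assoc]; gcongr))
    have h5 := hb p
    have h6 : ‖a (j u)‖ * ‖(R x).snd‖ ≤ c * ‖u‖ * ‖(R x).snd‖ := by gcongr
    have h7 : c * ‖u‖ * ‖(R x).snd‖ ≤ c * ‖u‖ ^ 2 + c * ‖(R x).snd‖ ^ 2 := by
      have : 0 ≤ ‖u‖ ^ 2 + ‖(R x).snd‖ ^ 2 - ‖u‖ * ‖(R x).snd‖ := by
        nlinarith [sq_nonneg (‖u‖ - ‖(R x).snd‖), sq_nonneg ‖u‖, sq_nonneg ‖(R x).snd‖]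
      nlinarith [mul_nonneg hc0 this]
    linarith
  have hinj : Function.Injective R := by
    rw [injective_iff_map_eq_zero]
    intro x hx
    have h1 := hR1 x
    have h2 := hR2 x
    simp only [hx, zero_sub, WithLp.zero_fst, WithLp.zero_snd, smul_zero, add_zero] at h1 h2
    have h3 : (-x).fst = 0 := hj (by rw [h1, map_zero])
    have h4 : x.fst = 0 := by
      rw [WithLp.neg_fst] at h3; exact neg_eq_zero.1 h3
    have h5 : (-x).snd = 0 := by
      refine hjd.eq_zero_of_inner_left ℝ ?_
      intro φ
      simpa [h3] using h2 φ
    have h6 : x.snd = 0 := by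
      rw [WithLp.neg_snd] at h5; exact neg_eq_zero.1 h5
    exact WithLp.ofLp_injective 2 (Prod.ext h4 h6)
  have hdense := denseRange_of_sq_le_inner hR hinj
  obtain ⟨S, -, hS0, hScont, hSR, hSd⟩ := exists_contraction_semigroup hR hdense
  -- `S` is generated by `𝒜 - c`; the factor `exp (c t)` undoes the shift
  refine ⟨fun t => Real.exp (c * t) • S t, range R, ?_, ?_, ?_, ?_, hdense, ?_⟩
  · simp [hS0]
  · intro x
    simp only [smul_apply]
    exact (Real.continuous_exp.comp (continuous_const.mul continuous_id)).smul (hScont x)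
  · refine hasDerivWithinAt_exp_smul_of_intertwining hSR hSd c (j ∘L WithLp.fstL 2 ℝ W Y) (WithLp.sndL 2 ℝ W Y) fun x => ?_
    change j (R x - x).fst = (R x).snd - c • j (R x).fst
    rw [← hR1 x]
    simp
  · intro x t ht φ
    have h := hasDerivWithinAt_exp_smul_of_intertwining hSR hSd c ((innerSL ℝ (j φ)) ∘L WithLp.sndL 2 ℝ W Y + (innerSL ℝ φ) ∘L b ∘L WithLp.fstL 2 ℝ W Y)
      (-((innerSL ℝ φ) ∘L WithLp.fstL 2 ℝ W Y + (innerSL ℝ (j φ)) ∘L a ∘L j ∘L WithLp.fstL 2 ℝ W Y))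
      (fun x => by
        change inner ℝ (j φ) (R x - x).snd + inner ℝ φ (b (R x - x).fst) =
          -(inner ℝ φ (R x).fst + inner ℝ (j φ) (a (j (R x).fst))) -
            c * (inner ℝ (j φ) (R x).snd + inner ℝ φ (b (R x).fst))
        have h2 := hR2 x φ
        simp only [map_add, map_smul, inner_add_left, inner_smul_left, conj_trivial] at h2
        simp only [real_inner_comm _ φ, real_inner_comm _ (j φ)]
        linarith) x t ht
    refine HasDerivWithinAt.congr_deriv (h.congr_of_mem (fun s _ => ?_) ht) ?_
    · exact congrArg₂ (· + ·) (real_inner_comm _ _) (real_inner_comm _ _)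
    · exact congrArg Neg.neg (congrArg₂ (· + ·) (real_inner_comm _ _) (real_inner_comm _ _))
  · rintro _ ⟨x, rfl⟩ t ht
    have h := (hasDerivWithinAt_exp_const_mul c t).smul (hSd x t ht)
    refine ⟨_, h, ?_, fun φ => ?_⟩
    · have h1 := hR1 (S t x)
      simp only [map_sub, hSR, smul_apply] at h1 ⊢
      rw [WithLp.add_fst, WithLp.smul_fst, WithLp.smul_fst, WithLp.smul_snd, ← h1]
      simp only [map_add, map_smul, smul_add, smul_smul, mul_comm]
    · have h2 := hR2 (S t x) φ
      simp only [map_sub, hSR, smul_apply] at h2 ⊢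
      simp only [WithLp.add_fst, WithLp.smul_fst, WithLp.smul_snd, WithLp.add_snd, inner_add_left,
        inner_smul_left, conj_trivial, map_add, map_smul] at h2 ⊢
      rw [h2]
      ring

end Wave

/-! ### Compact operators on orthonormal sequences -/

section WeaklyNull

/-- An infinite-dimensional inner product space contains an orthonormal sequence. -/
lemma exists_orthonormal_nat {V : Type*} [NormedAddCommGroup V] [InnerProductSpace ℝ V]
    (hV : ¬ FiniteDimensional ℝ V) : ∃ e : ℕ → V, Orthonormal ℝ e := by
  have hinf : Infinite (Module.Basis.ofVectorSpaceIndex ℝ V) := by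
    rw [← not_finite_iff_infinite]
    intro h
    exact hV (Module.Finite.of_basis (Module.Basis.ofVectorSpace ℝ V))
  have h := (Module.Basis.ofVectorSpace ℝ V).linearIndependent.comp _
    (Infinite.natEmbedding (Module.Basis.ofVectorSpaceIndex ℝ V)).injective
  exact ⟨_, InnerProductSpace.gramSchmidtNormed_orthonormal h⟩

/-- A compact operator maps an orthonormal sequence to a null sequence. -/
lemma IsCompactOperator.tendsto_zero_of_orthonormal {X Y : Type*}
    [NormedAddCommGroup X] [InnerProductSpace ℝ X] [CompleteSpace X]
    [NormedAddCommGroup Y] [InnerProductSpace ℝ Y] [CompleteSpace Y]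
    {K : X →L[ℝ] Y} (hK : IsCompactOperator K) {e : ℕ → X} (he : Orthonormal ℝ e) :
    Tendsto (fun n => K (e n)) atTop (𝓝 0) := by
  obtain ⟨C, hC, hKC⟩ :=
    IsCompactOperator.image_closedBall_subset_compact (f := (K : X →ₗ[ℝ] Y)) hK 1
  refine hC.tendsto_nhds_of_unique_mapClusterPt
    (Eventually.of_forall fun n => hKC ⟨e n, by simp [he.norm_eq_one], rfl⟩) fun y _ hy => ?_
  -- a cluster point `y` of `K eₙ` has `(y, y) = lim (eₙ, K† y) = 0`
  have h1 : Tendsto (fun n => inner ℝ (e n) (K.adjoint y)) atTop (𝓝 0) := by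
    have := (he.inner_products_summable (K.adjoint y)).tendsto_cofinite_zero
    rw [Nat.cofinite_eq_atTop] at this
    rw [tendsto_zero_iff_norm_tendsto_zero]
    simpa [Real.sqrt_sq_eq_abs] using this.sqrt
  have h2 : MapClusterPt (inner ℝ y y) atTop (fun n => inner ℝ (K (e n)) y) :=
    hy.continuousAt_comp (f := fun z => inner ℝ z y) (by fun_prop)
  simp only [ContinuousLinearMap.adjoint_inner_right] at h1
  have h3 : inner ℝ y y = 0 := by
    have := h2.clusterPt.mono h1
    exact eq_of_nhds_neBot this
  exact inner_self_eq_zero.1 h3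

end WeaklyNull

/-! ### Asymptotic conservation of energy -/

section Instability

variable {W Y : Type*} [NormedAddCommGroup W] [InnerProductSpace ℝ W]
  [NormedAddCommGroup Y] [InnerProductSpace ℝ Y]

/-- The block diagonal operator with diagonal `P`, `Q` on the Hilbert sum `W × Y`. -/
noncomputable def blockDiag (P : W →L[ℝ] W) (Q : Y →L[ℝ] Y) :
    WithLp 2 (W × Y) →L[ℝ] WithLp 2 (W × Y) :=
  ((WithLp.prodContinuousLinearEquiv 2 ℝ W Y).symm : W × Y →L[ℝ] WithLp 2 (W × Y)) ∘L
    ((P ∘L WithLp.fstL 2 ℝ W Y).prod (Q ∘L WithLp.sndL 2 ℝ W Y))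

lemma inner_blockDiag (P : W →L[ℝ] W) (Q : Y →L[ℝ] Y) (x y : WithLp 2 (W × Y)) :
    inner ℝ (blockDiag P Q x) y = inner ℝ (P x.fst) y.fst + inner ℝ (Q x.snd) y.snd :=
  rfl

/-- A symmetry `(P, Q)` of the wave equation that annihilates the damping operator `b` turns the
damping off: the quadratic form `(P u, u) + (Q v, v)` changes only through the lower order term
`a`. -/
lemma IsWaveSemigroup.hasDerivWithinAt_inner_blockDiag {j : W →L[ℝ] Y} {a : Y →L[ℝ] Y}
    {b : W →L[ℝ] W} {Z : ℝ → WithLp 2 (W × Y) →L[ℝ] WithLp 2 (W × Y)}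
    {D : Set (WithLp 2 (W × Y))} (hZ : IsWaveSemigroup j a b Z D)
    {P : W →L[ℝ] W} {Q : Y →L[ℝ] Y} (hP : ∀ u w, inner ℝ (P u) w = inner ℝ u (P w))
    (hQ : ∀ u w, inner ℝ (Q u) w = inner ℝ u (Q w)) (hPQ : ∀ u, j (P u) = Q (j u))
    (hPb : ∀ u, P (b u) = 0) {x : WithLp 2 (W × Y)} (hx : x ∈ D) {t : ℝ} (ht : 0 ≤ t) :
    HasDerivWithinAt (fun s => inner ℝ (blockDiag P Q (Z s x)) (Z s x))
      (-2 * inner ℝ (a (j (Z t x).fst)) (Q (Z t x).snd)) (Ici 0) t := by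
  obtain ⟨y, hy, hy1, hy2⟩ := hZ.hasDeriv x hx t ht
  have h := (((blockDiag P Q).hasFDerivAt.comp_hasDerivWithinAt t hy)).inner ℝ hy
  refine h.congr_deriv ?_
  change inner ℝ (blockDiag P Q (Z t x)) y + inner ℝ (blockDiag P Q y) (Z t x) = _
  have h3 := hy2 (P y.fst)
  rw [hPQ, hy1, ← hP (b _), hPb, inner_zero_left] at h3
  rw [inner_blockDiag, inner_blockDiag]
  have e1 := hP (Z t x).fst y.fst
  have e2 : inner ℝ (P y.fst) (Z t x).fst = inner ℝ (Z t x).fst (P y.fst) := real_inner_comm _ _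
  have e3 : inner ℝ (Q (Z t x).snd) y.snd = inner ℝ y.snd (Q (Z t x).snd) := real_inner_comm _ _
  have e4 := hQ y.snd (Z t x).snd
  linarith

variable [CompleteSpace W] [CompleteSpace Y]

/-- If a symmetry `(P, Q)` annihilates the damping operator and the embedding `j` is compact, then
the energy cannot decay exponentially: starting (almost) from `(w n, 0)` with `w n` orthonormal and
fixed by `P`, the form of `hasDerivWithinAt_inner_blockDiag` is asymptotically conserved, because
`j u` tends to zero along this sequence. -/
theorem IsWaveSemigroup.false_of_exponential_decay {j : W →L[ℝ] Y} {a : Y →L[ℝ] Y}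
    {b : W →L[ℝ] W} {Z : ℝ → WithLp 2 (W × Y) →L[ℝ] WithLp 2 (W × Y)}
    {D : Set (WithLp 2 (W × Y))} (hZ : IsWaveSemigroup j a b Z D) (hj : IsCompactOperator j)
    {P : W →L[ℝ] W} {Q : Y →L[ℝ] Y} (hP : ∀ u w, inner ℝ (P u) w = inner ℝ u (P w))
    (hQ : ∀ u w, inner ℝ (Q u) w = inner ℝ u (Q w)) (hPQ : ∀ u, j (P u) = Q (j u))
    (hPb : ∀ u, P (b u) = 0) {w : ℕ → W} (hw : Orthonormal ℝ w) (hPw : ∀ n, P (w n) = w n)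
    {M ω : ℝ} (hM : 0 ≤ M) (hω : 0 < ω)
    (hdecay : ∀ x t, 0 ≤ t → ‖Z t x‖ ≤ M * Real.exp (-ω * t) * ‖x‖) : False := by
  have hfst : ∀ x : WithLp 2 (W × Y), ‖x.fst‖ ≤ ‖x‖ := fun x => by
    refine (pow_le_pow_iff_left₀ (norm_nonneg _) (norm_nonneg _) two_ne_zero).1 ?_
    rw [WithLp.prod_norm_sq_eq_of_L2]
    exact le_add_of_nonneg_right (sq_nonneg _)
  have hsnd : ∀ x : WithLp 2 (W × Y), ‖x.snd‖ ≤ ‖x‖ := fun x => by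
    refine (pow_le_pow_iff_left₀ (norm_nonneg _) (norm_nonneg _) two_ne_zero).1 ?_
    rw [WithLp.prod_norm_sq_eq_of_L2]
    exact le_add_of_nonneg_left (sq_nonneg _)
  have hZM : ∀ x t, 0 ≤ t → ‖Z t x‖ ≤ M * ‖x‖ := fun x t ht => by
    refine (hdecay x t ht).trans ?_
    have : Real.exp (-ω * t) ≤ 1 := Real.exp_le_one_iff.2 (by nlinarith)
    gcongr
    exact mul_le_of_le_one_right hM this
  set B := blockDiag P Q with hB
  set e : ℕ → WithLp 2 (W × Y) := fun n => WithLp.toLp 2 (w n, 0) with he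
  have he_orth : Orthonormal ℝ e := by
    rw [orthonormal_iff_ite] at hw ⊢
    intro n m
    rw [← hw n m, WithLp.prod_inner_apply]
    simp [he]
  have happrox : ∀ n : ℕ, ∃ x ∈ D, ‖e n - x‖ < 1 / ((n : ℝ) + 1) := fun n => by
    obtain ⟨x, hx, h⟩ := hZ.dense.exists_dist_lt (e n) (show 0 < 1 / ((n : ℝ) + 1) by positivity)
    exact ⟨x, hx, by rwa [dist_eq_norm] at h⟩
  choose x hxD hxe using happrox
  have hxe0 : Tendsto (fun n => e n - x n) atTop (𝓝 0) :=
    squeeze_zero_norm (fun n => (hxe n).le) tendsto_one_div_add_atTop_nhds_zero_nat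
  have hx2 : ∀ n, ‖x n‖ ≤ 2 := by
    intro n
    have h1 : 1 / ((n : ℝ) + 1) ≤ 1 := by
      rw [div_le_one (by positivity)]
      linarith [Nat.cast_nonneg (α := ℝ) n]
    have h2 := norm_sub_norm_le (x n) (e n)
    rw [norm_sub_rev, he_orth.norm_eq_one] at h2
    linarith [hxe n]
  -- `j u(s)` tends to zero for each `s`
  have hjx : ∀ s, Tendsto (fun n => j (Z s (x n)).fst) atTop (𝓝 0) := by
    intro s
    set K : WithLp 2 (W × Y) →L[ℝ] Y := j ∘L (WithLp.fstL 2 ℝ W Y ∘L Z s) with hK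
    have h1 : IsCompactOperator K := hj.comp_clm (WithLp.fstL 2 ℝ W Y ∘L Z s)
    have h2 := (h1.tendsto_zero_of_orthonormal he_orth).sub ((K.continuous.tendsto _).comp hxe0)
    simp only [Function.comp_def, map_sub, map_zero, sub_zero, sub_sub_cancel] at h2
    exact h2
  have hQx : Tendsto (fun n => inner ℝ (B (x n)) (x n)) atTop (𝓝 1) := by
    have h1 : ∀ n, inner ℝ (B (x n)) (x n) =
        1 - inner ℝ (B (x n)) (e n - x n) - inner ℝ (B (e n - x n)) (e n) := by
      intro n
      have h2 : inner ℝ (B (e n)) (e n) = 1 := by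
        rw [hB, inner_blockDiag]
        change inner ℝ (P (w n)) (w n) + inner ℝ (Q 0) 0 = 1
        rw [hPw, real_inner_self_eq_norm_sq, hw.norm_eq_one]
        simp
      rw [inner_sub_right, map_sub, inner_sub_left, h2]
      ring
    have h3 : Tendsto (fun n => ‖B‖ * 2 * ‖e n - x n‖) atTop (𝓝 0) := by
      simpa using hxe0.norm.const_mul (‖B‖ * 2)
    have h4 : Tendsto (fun n => inner ℝ (B (x n)) (e n - x n)) atTop (𝓝 0) := by
      refine squeeze_zero_norm (fun n => (norm_inner_le_norm _ _).trans ?_) h3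
      gcongr
      exact (B.le_opNorm _).trans (by gcongr; exact hx2 n)
    have h5 : Tendsto (fun n => inner ℝ (B (e n - x n)) (e n)) atTop (𝓝 0) := by
      refine squeeze_zero_norm (fun n => (norm_inner_le_norm _ _).trans ?_) h3
      rw [he_orth.norm_eq_one, mul_one]
      refine (B.le_opNorm _).trans ?_
      gcongr
      linarith [norm_nonneg B]
    simp only [h1]
    simpa using (h4.const_sub 1).sub h5
  have hcontZ : ∀ n, Continuous fun s => Z s (x n) := fun n => hZ.continuous (x n)
  have hcontd : ∀ n, Continuous fun s =>
      -2 * inner ℝ (a (j (Z s (x n)).fst)) (Q (Z s (x n)).snd) := by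
    intro n
    have h1 : Continuous fun s => a (j (Z s (x n)).fst) :=
      (a ∘L j ∘L WithLp.fstL 2 ℝ W Y).continuous.comp (hcontZ n)
    have h2 : Continuous fun s => Q (Z s (x n)).snd :=
      (Q ∘L WithLp.sndL 2 ℝ W Y).continuous.comp (hcontZ n)
    exact continuous_const.mul (h1.inner h2)
  have hint : ∀ n t, 0 ≤ t → inner ℝ (B (Z t (x n))) (Z t (x n)) = inner ℝ (B (x n)) (x n) +
      ∫ s in (0 : ℝ)..t, -2 * inner ℝ (a (j (Z s (x n)).fst)) (Q (Z s (x n)).snd) := by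
    intro n t ht
    have h := intervalIntegral.integral_eq_sub_of_hasDerivAt_of_le ht
      (f := fun s => inner ℝ (B (Z s (x n))) (Z s (x n)))
      (((B.continuous.comp (hcontZ n)).inner (hcontZ n)).continuousOn)
      (fun s hs => (hZ.hasDerivWithinAt_inner_blockDiag hP hQ hPQ hPb (hxD n) hs.1.le).hasDerivAt
        (Ici_mem_nhds hs.1)) ((hcontd n).intervalIntegrable _ _)
    rw [h, hZ.zero]
    simp
  have hbound : ∀ n s, 0 ≤ s → ‖-2 * inner ℝ (a (j (Z s (x n)).fst)) (Q (Z s (x n)).snd)‖ ≤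
      2 * (‖a‖ * ‖j (Z s (x n)).fst‖) * (‖Q‖ * (M * 2)) := by
    intro n s hs
    rw [norm_mul, norm_neg, Real.norm_ofNat, mul_assoc]
    refine mul_le_mul_of_nonneg_left ((norm_inner_le_norm _ _).trans ?_) two_pos.le
    gcongr
    · exact a.le_opNorm _
    · refine (Q.le_opNorm _).trans ?_
      gcongr
      exact (hsnd _).trans ((hZM _ s hs).trans (by gcongr; exact hx2 n))
  have hlim : ∀ t, 0 ≤ t → Tendsto (fun n => ∫ s in (0 : ℝ)..t,
      -2 * inner ℝ (a (j (Z s (x n)).fst)) (Q (Z s (x n)).snd)) atTop (𝓝 0) := by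
    intro t ht
    have h := intervalIntegral.tendsto_integral_filter_of_dominated_convergence
      (μ := MeasureTheory.volume) (a := 0) (b := t) (l := atTop)
      (F := fun n s => -2 * inner ℝ (a (j (Z s (x n)).fst)) (Q (Z s (x n)).snd)) (f := fun _ => 0)
      (fun _ => 2 * (‖a‖ * (‖j‖ * (M * 2))) * (‖Q‖ * (M * 2)))
      (Eventually.of_forall fun n => (hcontd n).aestronglyMeasurable)
      (Eventually.of_forall fun n => Eventually.of_forall fun s hs => ?_)
      intervalIntegrable_const
      (Eventually.of_forall fun s hs => ?_)
    · simpa using h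
    · rw [uIoc_of_le ht] at hs
      refine (hbound n s hs.1.le).trans ?_
      gcongr
      refine (j.le_opNorm _).trans ?_
      gcongr
      exact (hfst _).trans ((hZM _ s hs.1.le).trans (by gcongr; exact hx2 n))
    · rw [uIoc_of_le ht] at hs
      refine squeeze_zero_norm (fun n => hbound n s hs.1.le) ?_
      simpa using ((((hjx s).norm).const_mul ‖a‖).const_mul 2).mul_const (‖Q‖ * (M * 2))
  have hconserved : ∀ t, 0 ≤ t →
      Tendsto (fun n => inner ℝ (B (Z t (x n))) (Z t (x n))) atTop (𝓝 1) := by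
    intro t ht
    simp only [hint _ t ht]
    simpa using hQx.add (hlim t ht)
  have hsmall : ∀ t, 0 ≤ t → 1 ≤ ‖B‖ * (M * Real.exp (-ω * t) * 2) ^ 2 := by
    intro t ht
    refine le_of_tendsto (hconserved t ht) (Eventually.of_forall fun n => ?_)
    refine (real_inner_le_norm _ _).trans ?_
    have h1 : ‖Z t (x n)‖ ≤ M * Real.exp (-ω * t) * 2 :=
      (hdecay _ t ht).trans (by gcongr; exact hx2 n)
    calc ‖B (Z t (x n))‖ * ‖Z t (x n)‖ ≤ ‖B‖ * ‖Z t (x n)‖ * ‖Z t (x n)‖ := by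
          gcongr; exact B.le_opNorm _
      _ = ‖B‖ * ‖Z t (x n)‖ ^ 2 := by ring
      _ ≤ _ := by gcongr
  have hexp : Tendsto (fun t : ℝ => ‖B‖ * (M * Real.exp (-ω * t) * 2) ^ 2) atTop (𝓝 0) := by
    have h1 : Tendsto (fun t : ℝ => Real.exp (-ω * t)) atTop (𝓝 0) := by
      refine Real.tendsto_exp_atBot.comp ?_
      exact tendsto_id.const_mul_atTop_of_neg (by linarith)
    simpa using (((h1.const_mul M).mul_const 2).pow 2).const_mul ‖B‖
  have := ge_of_tendsto hexp ((eventually_ge_atTop (0 : ℝ)).mono fun t ht => hsmall t ht)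
  linarith

end Instability

/-! ### Matrices acting on tuples -/

section MatrixOperators

variable {V₁ V₂ V₃ : Type*} [NormedAddCommGroup V₁] [InnerProductSpace ℝ V₁]
  [NormedAddCommGroup V₂] [InnerProductSpace ℝ V₂] [NormedAddCommGroup V₃] [InnerProductSpace ℝ V₃]
  {N : ℕ}

/-- The operator `M ⊗ F` on `N`-tuples, `(M ⊗ F) u = (∑ l, M k l F u_l)_k`, between Hilbert sums. -/
noncomputable def matrixTensor (M : Matrix (Fin N) (Fin N) ℝ) (F : V₁ →L[ℝ] V₂) :
    PiLp 2 (fun _ : Fin N => V₁) →L[ℝ] PiLp 2 (fun _ : Fin N => V₂) :=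
  ((PiLp.continuousLinearEquiv 2 ℝ (fun _ : Fin N => V₂)).symm :
      (Fin N → V₂) →L[ℝ] PiLp 2 (fun _ : Fin N => V₂)) ∘L
    ContinuousLinearMap.pi fun k => ∑ l, M k l • (F ∘L PiLp.proj 2 (fun _ : Fin N => V₁) l)

lemma matrixTensor_apply (M : Matrix (Fin N) (Fin N) ℝ) (F : V₁ →L[ℝ] V₂)
    (u : PiLp 2 (fun _ : Fin N => V₁)) (k : Fin N) :
    matrixTensor M F u k = ∑ l, M k l • F (u l) := by
  simp [matrixTensor]

lemma matrixTensor_one_apply (F : V₁ →L[ℝ] V₂) (u : PiLp 2 (fun _ : Fin N => V₁)) (k : Fin N) :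
    matrixTensor 1 F u k = F (u k) := by
  simp [matrixTensor_apply, Matrix.one_apply]

lemma matrixTensor_mul (M M' : Matrix (Fin N) (Fin N) ℝ) (F : V₂ →L[ℝ] V₃) (F' : V₁ →L[ℝ] V₂)
    (u : PiLp 2 (fun _ : Fin N => V₁)) :
    matrixTensor M F (matrixTensor M' F' u) = matrixTensor (M * M') (F ∘L F') u := by
  ext k
  simp only [matrixTensor_apply, map_sum, map_smul, Finset.smul_sum, smul_smul, Matrix.mul_apply,
    Finset.sum_smul, ContinuousLinearMap.comp_apply]
  exact Finset.sum_comm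

lemma inner_matrixTensor_id (M : Matrix (Fin N) (Fin N) ℝ) (u w : PiLp 2 (fun _ : Fin N => V₁)) :
    inner ℝ (matrixTensor M (.id ℝ V₁) u) w = inner ℝ u (matrixTensor M.transpose (.id ℝ V₁) w) := by
  simp only [PiLp.inner_apply, matrixTensor_apply, sum_inner, inner_sum, inner_smul_left,
    inner_smul_right, Matrix.transpose_apply, ContinuousLinearMap.id_apply, conj_trivial]
  exact Finset.sum_comm

lemma inner_matrixTensor_nonneg {D : Matrix (Fin N) (Fin N) ℝ} (hD : D.PosSemidef)
    {F : V₁ →L[ℝ] V₁} (hF : ∀ u, 0 ≤ inner ℝ (F u) u) (u : PiLp 2 (fun _ : Fin N => V₁)) :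
    0 ≤ inner ℝ (matrixTensor D F u) u := by
  obtain ⟨C, hC, hCD⟩ : ∃ C : Matrix (Fin N) (Fin N) ℝ, C.transpose = C ∧ C * C = D := by
    open scoped MatrixOrder in
    refine ⟨CFC.sqrt D, ?_, by rw [← sq]; exact CFC.sq_sqrt D hD.nonneg⟩
    exact (Matrix.nonneg_iff_posSemidef.1 (CFC.sqrt_nonneg D)).isHermitian
  have h1 : matrixTensor D F u
      = matrixTensor C (.id ℝ V₁) (matrixTensor 1 F (matrixTensor C (.id ℝ V₁) u)) := by
    rw [matrixTensor_mul, matrixTensor_mul, mul_one, hCD]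
    rfl
  rw [h1, inner_matrixTensor_id, hC, PiLp.inner_apply]
  refine Finset.sum_nonneg fun k _ => ?_
  rw [matrixTensor_one_apply]
  exact hF _

lemma IsCompactOperator.matrixTensor_one {F : V₁ →L[ℝ] V₂} (hF : IsCompactOperator F) :
    IsCompactOperator (matrixTensor (N := N) 1 F) := by
  obtain ⟨K, hK, hKF⟩ := hF
  refine ⟨WithLp.toLp 2 '' (univ.pi fun _ => K),
    (isCompact_univ_pi fun _ => hK).image (PiLp.continuous_toLp 2 _), ?_⟩
  have h : (⋂ k : Fin N, PiLp.proj (𝕜 := ℝ) 2 (fun _ : Fin N => V₁) k ⁻¹' (F ⁻¹' K)) ∈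
      𝓝 (0 : PiLp 2 (fun _ : Fin N => V₁)) := by
    refine iInter_mem.2 fun k => ?_
    refine (PiLp.proj (𝕜 := ℝ) 2 (fun _ : Fin N => V₁) k).continuous.continuousAt.preimage_mem_nhds ?_
    rwa [map_zero]
  refine mem_of_superset h fun u hu => ⟨fun k => F (u k), fun k _ => mem_iInter.1 hu k, ?_⟩
  ext k
  rw [matrixTensor_one_apply]

lemma denseRange_matrixTensor_one {F : V₁ →L[ℝ] V₂} (hF : DenseRange F) :
    DenseRange (matrixTensor (N := N) 1 F) := by
  have h1 : DenseRange (Pi.map fun _ : Fin N => (F : V₁ → V₂)) := .piMap fun _ => hF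
  have h2 := (PiLp.continuousLinearEquiv 2 ℝ (fun _ : Fin N => V₂)).symm.surjective.denseRange.comp h1
    (PiLp.continuousLinearEquiv 2 ℝ (fun _ : Fin N => V₂)).symm.continuous
  refine h2.mono ?_
  rintro _ ⟨u, rfl⟩
  refine ⟨WithLp.toLp 2 u, ?_⟩
  ext k
  rw [matrixTensor_one_apply]
  rfl

lemma inner_toLp_single (u : PiLp 2 (fun _ : Fin N => V₁)) (k : Fin N) (φ : V₁) :
    inner ℝ u (WithLp.toLp 2 (Pi.single k φ)) = inner ℝ (u k) φ := by
  rw [PiLp.inner_apply, Finset.sum_eq_single k]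
  · simp
  · intro l _ hl
    simp [hl]
  · simp

lemma matrixTensor_one_toLp_single (F : V₁ →L[ℝ] V₂) (k : Fin N) (φ : V₁) :
    matrixTensor 1 F (WithLp.toLp 2 (Pi.single k φ)) = WithLp.toLp 2 (Pi.single k (F φ)) := by
  ext l
  rw [matrixTensor_one_apply]
  exact Pi.apply_single (fun _ => F) (fun _ => map_zero F) k φ l

end MatrixOperators

/-! ### Application to the system -/

/-- A singular square matrix has a unit vector in its left kernel. -/
lemma exists_unit_vecMul_eq_zero {N : ℕ} {D : Matrix (Fin N) (Fin N) ℝ} (hD : D.rank ≠ N) :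
    ∃ e : Fin N → ℝ, ∑ k, e k ^ 2 = 1 ∧ Matrix.vecMul e D = 0 := by
  have hdet : D.det = 0 := by
    by_contra h
    exact hD (by simpa using Matrix.rank_of_det_ne_zero h)
  obtain ⟨v, hv0, hv⟩ := Matrix.exists_vecMul_eq_zero_iff.2 hdet
  have hpos : 0 < ∑ k, v k ^ 2 := by
    obtain ⟨k, hk⟩ := Function.ne_iff.1 hv0
    exact Finset.sum_pos' (fun _ _ => sq_nonneg _) ⟨k, Finset.mem_univ _, by
      have : v k ≠ 0 := hk
      positivity⟩
  refine ⟨(Real.sqrt (∑ k, v k ^ 2))⁻¹ • v, ?_, ?_⟩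
  · simp only [Pi.smul_apply, smul_eq_mul, mul_pow, ← Finset.mul_sum, inv_pow,
      Real.sq_sqrt hpos.le]
    exact inv_mul_cancel₀ hpos.ne'
  · rw [Matrix.smul_vecMul, hv, smul_zero]

lemma energyNorm_eq_norm {V H : Type*} [NormedAddCommGroup V] [InnerProductSpace ℝ V]
    [NormedAddCommGroup H] [InnerProductSpace ℝ H] {N : ℕ}
    (x : WithLp 2 (PiLp 2 (fun _ : Fin N => V) × PiLp 2 (fun _ : Fin N => H))) :
    energyNorm x.fst.ofLp x.snd.ofLp = ‖x‖ := by
  rw [energyNorm, WithLp.prod_norm_eq_of_L2, PiLp.norm_sq_eq_of_L2, PiLp.norm_sq_eq_of_L2,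
    Finset.sum_add_distrib]

/-- For `j = 1 ⊗ i`, `a = A ⊗ 1`, `b = D ⊗ G` with `G` the Riesz representation of `g`, testing the
abstract equation with tuples that have one nonzero entry gives the weak form of the system. -/
lemma IsWaveSemigroup.isWeakSolution {V H : Type*}
    [NormedAddCommGroup V] [InnerProductSpace ℝ V] [NormedAddCommGroup H] [InnerProductSpace ℝ H]
    {N : ℕ} {i : V →L[ℝ] H} {g : V →L[ℝ] StrongDual ℝ V} {A D : Matrix (Fin N) (Fin N) ℝ}
    {G : V →L[ℝ] V} (hG : ∀ u φ, inner ℝ (G u) φ = g u φ)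
    {Z : ℝ → WithLp 2 (PiLp 2 (fun _ : Fin N => V) × PiLp 2 (fun _ : Fin N => H)) →L[ℝ]
      WithLp 2 (PiLp 2 (fun _ : Fin N => V) × PiLp 2 (fun _ : Fin N => H))}
    {S : Set (WithLp 2 (PiLp 2 (fun _ : Fin N => V) × PiLp 2 (fun _ : Fin N => H)))}
    (hZ : IsWaveSemigroup (matrixTensor 1 i) (matrixTensor A (.id ℝ H)) (matrixTensor D G) Z S)
    (x : WithLp 2 (PiLp 2 (fun _ : Fin N => V) × PiLp 2 (fun _ : Fin N => H))) :
    IsWeakSolution i g A D x.fst.ofLp x.snd.ofLp (fun t => (Z t x).fst.ofLp)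
      (fun t => (Z t x).snd.ofLp) where
  continuousOn := ((PiLp.continuous_ofLp 2 _).comp
    ((WithLp.fstL 2 ℝ _ _).continuous.comp (hZ.continuous x))).continuousOn
  continuousOn_deriv := ((PiLp.continuous_ofLp 2 _).comp
    ((WithLp.sndL 2 ℝ _ _).continuous.comp (hZ.continuous x))).continuousOn
  hasDeriv t ht k := by
    have h := (PiLp.proj 2 (fun _ : Fin N => H) k).hasFDerivAt.comp_hasDerivWithinAt t
      (hZ.hasDeriv_fst x t ht)
    refine h.congr_of_mem (fun s _ => ?_) ht
    exact (matrixTensor_one_apply i (Z s x).fst k).symm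
  equation t ht k φ := by
    have h := hZ.hasDeriv_snd x t ht (WithLp.toLp 2 (Pi.single k φ))
    simp only [matrixTensor_one_toLp_single, inner_toLp_single] at h
    refine (h.congr_of_mem (fun s _ => ?_) ht).congr_deriv ?_
    · simp [matrixTensor_apply, sum_inner, inner_smul_left, hG]
    · simp [matrixTensor_apply A, matrixTensor_one_apply, sum_inner, inner_smul_left]
  initial := by rw [hZ.zero]; rfl
  initial_deriv := by rw [hZ.zero]; rfl

theorem corollary2p10 {V H : Type*}
    [NormedAddCommGroup V] [InnerProductSpace ℝ V] [CompleteSpace V]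
    [NormedAddCommGroup H] [InnerProductSpace ℝ H] [CompleteSpace H]
    (hV : ¬ FiniteDimensional ℝ V)
    (i : V →L[ℝ] H) (hi_inj : Function.Injective i) (hi_dense : DenseRange i)
    (hi_compact : IsCompactOperator i)
    (g : V →L[ℝ] StrongDual ℝ V) (hg_symm : ∀ u v : V, g u v = g v u)
    (hg_nonneg : ∀ u : V, 0 ≤ g u u)
    {N : ℕ} (A D : Matrix (Fin N) (Fin N) ℝ) (hA : A.PosSemidef) (hD : D.PosSemidef)
    (hstable : UniformlyStable i g A D) :
    D.rank = N := by
  by_contra hrank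
  obtain ⟨e, he1, heD⟩ := exists_unit_vecMul_eq_zero hrank
  obtain ⟨M, ω, hM, hω, hdecay⟩ := hstable
  obtain ⟨f, hf⟩ := exists_orthonormal_nat hV
  -- the Riesz representation of `g`
  set G : V →L[ℝ] V := InnerProductSpace.continuousLinearMapOfBilin (𝕜 := ℝ) g
  have hG : ∀ u φ, inner ℝ (G u) φ = g u φ :=
    InnerProductSpace.continuousLinearMapOfBilin_apply (𝕜 := ℝ) g
  have hinj : Function.Injective (matrixTensor (N := N) 1 i) := by
    intro u w huw
    ext k
    have := congrArg (fun v : PiLp 2 (fun _ : Fin N => H) => v k) huw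
    simp only [matrixTensor_one_apply] at this
    exact hi_inj this
  obtain ⟨Z, S, hZ⟩ := exists_isWaveSemigroup (matrixTensor (N := N) 1 i) hinj
    (denseRange_matrixTensor_one hi_dense) (matrixTensor A (.id ℝ H)) (matrixTensor D G)
    (inner_matrixTensor_nonneg hD fun u => by rw [hG]; exact hg_nonneg u)
  set P : Matrix (Fin N) (Fin N) ℝ := Matrix.vecMulVec e e with hPdef
  have hPT : P.transpose = P := by rw [hPdef, Matrix.transpose_vecMulVec]
  have hPD : P * D = 0 := by
    rw [hPdef, Matrix.vecMulVec_mul, heD, Matrix.vecMulVec_zero]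
  have hPe : ∀ k, ∑ l, P k l * e l = e k := by
    intro k
    simp only [hPdef, Matrix.vecMulVec_apply, mul_assoc, ← Finset.mul_sum, ← sq, he1, mul_one]
  refine hZ.false_of_exponential_decay hi_compact.matrixTensor_one
    (P := matrixTensor P (.id ℝ V)) (Q := matrixTensor P (.id ℝ H))
    (w := fun n => WithLp.toLp 2 fun k => e k • f n) (M := M) (ω := ω)
    (fun u w => by rw [inner_matrixTensor_id, hPT]) (fun u w => by rw [inner_matrixTensor_id, hPT])
    (fun u => ?_) (fun u => ?_) ?_ (fun n => ?_) (by linarith) hω (fun x t ht => ?_)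
  · rw [matrixTensor_mul, matrixTensor_mul, one_mul, mul_one]
    rfl
  · rw [matrixTensor_mul, hPD]
    ext k
    simp [matrixTensor_apply]
  · rw [orthonormal_iff_ite] at hf ⊢
    intro n m
    rw [PiLp.inner_apply]
    simp only [inner_smul_left, inner_smul_right, conj_trivial, hf n m, ← mul_assoc,
      ← Finset.sum_mul, ← sq, he1, one_mul]
  · ext k
    simp only [matrixTensor_apply, ContinuousLinearMap.id_apply, smul_smul, ← Finset.sum_smul, hPe]
  · have h := hdecay _ _ _ _ (hZ.isWeakSolution hG x) t ht
    rwa [energyNorm_eq_norm, energyNorm_eq_norm] at h
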